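/- Let $H_S\in\mathbb C^{n\times n}$ be Hermitian, and assume that there are $E_1\in\mathbb R$ and $\Delta E>0$ such that $\sigma(H_S)\subseteq\{E_1+j\Delta E: j\in\mathbb N_0\}$. For a finite temperature $T>0$, $m\geq 1$, a Hermitian matrix $H_B\in\mathbb C^{m\times m}$ and a unitary $U\in\mathbb C^{nm\times nm}$, define the linear map on $\mathbb C^{n\times n}$ $$\Phi_{T,m}(H_B,U)(A)=\operatorname{tr}_B\Big(U\Big(A\otimes \frac{e^{-H_B/T}}{\operatorname{tr}(e^{-H_B/T})}\Big)U^*\Big),$$ where $\operatorname{tr}_B$ is the partial trace over the second factor of $\mathbb C^n\otimes\mathbb C^m$; for $T=\infty$ set $\Phi_{\infty,m}(H_B,U):=\Phi_{1,m}(\mathbb 1_m,U)$, so that the Gibbs state is replaced by $\mathbb 1_m/m$. For $T\in(0,\infty]$ let $$\mathsf{TO}(H_S,T)=\bigcup_{m\ge1}\Big\{\Phi_{T,m}(H_B,U):\ H_B \text{ Hermitian},\ U\text{ unitary},\ U(H_S\otimes\mathbb 1+\mathbb 1\otimes H_B)U^*=H_S\otimes\mathbb 1+\mathbb 1\otimes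 H_B\Big\}.$$ For $\beta=(\beta_1,\dots,\beta_m)\in\mathbb N_0^m$ with $|\beta|:=\sum_j\beta_j>0$ put $H_\beta=\bigoplus_{j=1}^m j\,\Delta E\,\mathbb 1_{\beta_j}$ and $$\mathcal S_\beta(T)=\Big\{\Phi_{T,|\beta|}\big(H_\beta,e^{iH_{\mathsf{tot}}}\big):\ H_{\mathsf{tot}}\text{ Hermitian of size } n|\beta|,\ [H_{\mathsf{tot}},H_S\otimes\mathbb 1+\mathbb 1\otimes H_\beta]=0\Big\}.$$ Define $\mathsf{TO}^{\Delta E}_{\mathsf{Spin}}(H_S,T)=\bigcup_{m\ge 1}\bigcup_{\beta_1,\dots,\beta_m\ge 1}\mathcal S_\beta(T)$. Then for every $T\in(0,\infty]$, with closures taken in the space of linear maps on $\mathbb C^{n\times n}$, $$\overline{\mathsf{TO}^{\Delta E}_{\mathsf{Spin}}(H_S,T)}=\overline{\bigcup_{m\ge 1}\ \bigcup_{\beta\in\mathbb N_0^m,\ |\beta|>0}\mathcal S_\beta(T)}\qquad\text{and}\qquad \overline{\mathsf{TO}(H_S,T)}=\overline{\mathsf{TO}^{\Delta E}_{\mathsf{Spin}}(H_S,T)}.$$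 -/

import Mathlib

open scoped Kronecker ENNReal

noncomputable section

/-- The partial trace `tr_B` over the second tensor factor: `(tr_B X) i j = ∑ k, X (i, k) (j, k)`. -/
def partialTraceBath {s b : Type*} [Fintype b] (X : Matrix (s × b) (s × b) ℂ) : Matrix s s ℂ :=
  Matrix.of fun i j => ∑ k, X (i, k) (j, k)

/-- The Gibbs state `e^{-H/T} / tr (e^{-H/T})` at finite temperature `T`. -/
def gibbsState {b : Type*} [Fintype b] [DecidableEq b] (T : ℝ) (H : Matrix b b ℂ) :
    Matrix b b ℂ :=
  (NormedSpace.exp (-(T⁻¹ • H))).trace⁻¹ • NormedSpace.exp (-(T⁻¹ • H))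

/-- The linear map `Φ_T(H_B, U) : A ↦ tr_B (U (A ⊗ e^{-H_B/T} / tr (e^{-H_B/T})) U*)`. -/
def bathMap {n : ℕ} {b : Type*} [Fintype b] [DecidableEq b] (T : ℝ) (HB : Matrix b b ℂ)
    (U : Matrix (Fin n × b) (Fin n × b) ℂ) :
    Matrix (Fin n) (Fin n) ℂ →ₗ[ℂ] Matrix (Fin n) (Fin n) ℂ where
  toFun A := partialTraceBath (U * (A ⊗ₖ gibbsState T HB) * U.conjTranspose)
  map_add' A A' := by
    ext i j
    simp [partialTraceBath, Matrix.add_kronecker, Matrix.mul_add, Matrix.add_mul,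
      Finset.sum_add_distrib]
  map_smul' c A := by
    ext i j
    simp [partialTraceBath, Matrix.smul_kronecker, Finset.mul_sum]

/-- The map generated by the bath Hamiltonian `HB` and the unitary `U` at temperature
`T ∈ (0, ∞]`: this is `Φ_T(H_B, U)` for finite `T`, and `Φ_1(1, U)`, i.e. the bath is in the
maximally mixed state, for `T = ∞`. It is bundled as an element of the (finite-dimensional) space
of continuous linear maps, which carries the operator-norm topology. -/
def thermalMap {n : ℕ} {b : Type*} [Fintype b] [DecidableEq b] (T : ℝ≥0∞) (HB : Matrix b b ℂ)
    (U : Matrix (Fin n × b) (Fin n × b) ℂ) :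
    Matrix (Fin n) (Fin n) ℂ →L[ℂ] Matrix (Fin n) (Fin n) ℂ :=
  LinearMap.toContinuousLinearMap (if T = ⊤ then bathMap 1 1 U else bathMap T.toReal HB U)

/-- The uncoupled total Hamiltonian `H_S ⊗ 1 + 1 ⊗ H_B`. -/
def freeHamiltonian {n : ℕ} {b : Type*} [DecidableEq b]
    (HS : Matrix (Fin n) (Fin n) ℂ) (HB : Matrix b b ℂ) :
    Matrix (Fin n × b) (Fin n × b) ℂ :=
  HS ⊗ₖ (1 : Matrix b b ℂ) + (1 : Matrix (Fin n) (Fin n) ℂ) ⊗ₖ HB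

/-- The thermal operations `TO(H_S, T)`. -/
def thermalOperations {n : ℕ} (HS : Matrix (Fin n) (Fin n) ℂ) (T : ℝ≥0∞) :
    Set (Matrix (Fin n) (Fin n) ℂ →L[ℂ] Matrix (Fin n) (Fin n) ℂ) :=
  {S | ∃ (m : ℕ) (HB : Matrix (Fin m) (Fin m) ℂ)
      (U : Matrix (Fin n × Fin m) (Fin n × Fin m) ℂ),
    0 < m ∧ HB.IsHermitian ∧ U ∈ Matrix.unitaryGroup (Fin n × Fin m) ℂ ∧
    U * freeHamiltonian HS HB * U.conjTranspose = freeHamiltonian HS HB ∧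
    S = thermalMap T HB U}

/-- The spin Hamiltonian `⊕_{j=1}^m j ΔE 1_{β_j}`; the index `j : Fin m` stands for `j + 1`. -/
def spinHamiltonian (ΔE : ℝ) {m : ℕ} (β : Fin m → ℕ) :
    Matrix (Σ j : Fin m, Fin (β j)) (Σ j : Fin m, Fin (β j)) ℂ :=
  Matrix.blockDiagonal' fun j : Fin m =>
    (((j : ℕ) + 1 : ℝ) * ΔE) • (1 : Matrix (Fin (β j)) (Fin (β j)) ℂ)

/-- The maps generated by the spin bath with gap `ΔE` and degeneracies `β`, together with
`e^{i H_tot}` for some Hermitian `H_tot` that commutes with `H_S ⊗ 1 + 1 ⊗ H_B`. -/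
def spinBathOperations {n : ℕ} (HS : Matrix (Fin n) (Fin n) ℂ) (ΔE : ℝ) (T : ℝ≥0∞) {m : ℕ}
    (β : Fin m → ℕ) : Set (Matrix (Fin n) (Fin n) ℂ →L[ℂ] Matrix (Fin n) (Fin n) ℂ) :=
  {S | ∃ Htot : Matrix (Fin n × Σ j : Fin m, Fin (β j)) (Fin n × Σ j : Fin m, Fin (β j)) ℂ,
    Htot.IsHermitian ∧ ⁅Htot, freeHamiltonian HS (spinHamiltonian ΔE β)⁆ = 0 ∧
    S = thermalMap T (spinHamiltonian ΔE β) (NormedSpace.exp (Complex.I • Htot))}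

/-- `TO_Spin^{ΔE}(H_S, T)`: all degeneracies are positive. -/
def spinThermalOperations {n : ℕ} (HS : Matrix (Fin n) (Fin n) ℂ) (ΔE : ℝ) (T : ℝ≥0∞) :
    Set (Matrix (Fin n) (Fin n) ℂ →L[ℂ] Matrix (Fin n) (Fin n) ℂ) :=
  {S | ∃ (m : ℕ) (β : Fin m → ℕ), 0 < m ∧ (∀ j, 0 < β j) ∧ S ∈ spinBathOperations HS ΔE T β}

/-- The variant in which degeneracies may vanish, as long as not all of them do. -/
def spinThermalOperationsWithGaps {n : ℕ} (HS : Matrix (Fin n) (Fin n) ℂ) (ΔE : ℝ) (T : ℝ≥0∞) :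
    Set (Matrix (Fin n) (Fin n) ℂ →L[ℂ] Matrix (Fin n) (Fin n) ℂ) :=
  {S | ∃ (m : ℕ) (β : Fin m → ℕ), 0 < m ∧ 0 < ∑ j, β j ∧ S ∈ spinBathOperations HS ΔE T β}

end

/-!
In an eigenbasis of `H_B` with energies `e`, a unitary is an array of `n × n` blocks `B l k`, and it
commutes with `H_S ⊗ 1 + 1 ⊗ H_B` iff `[H_S, B l k] = (e k - e l) B l k`. Hence `B l k ≠ 0` forces
`e k - e l` to be a difference of eigenvalues of `H_S`, so a multiple of `ΔE`. The generated map is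
the mixture of the maps `A ↦ ∑ l, B l k * A * (B l k)ᴴ` with Boltzmann weights.

Replacing every level `k` by `N k` degenerate copies, with `N` constant along the nonzero blocks,
keeps the unitary energy conserving and multiplies the `k`-th weight by `N k`. Two limits of such
degeneracies suffice.

* Write `e k = r k + (E k + 1) ΔE` with `r` constant along the nonzero blocks. Then `B` also
  conserves energy for the spin energies `(E k + 1) ΔE`, and degeneracies asymptotically
  proportional to `exp (-r k / T)` restore the Boltzmann weights of `e`.
* Adjoin to a spin bath one uncoupled level on each rung, and copy only the original levels `M`
  times: no rung is empty, and the weight of the new levels tends to zero.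
-/

section CommutingMatrices

open Matrix

theorem exists_isHermitian_exp_eq {ι : Type*} [Fintype ι] [DecidableEq ι] {U K : Matrix ι ι ℂ}
    (hU : U ∈ unitaryGroup ι ℂ) (hK : Commute U K) :
    ∃ H : Matrix ι ι ℂ, H.IsHermitian ∧ Commute H K ∧ NormedSpace.exp (Complex.I • H) = U := by
  open scoped Matrix.Norms.L2Operator in
  have : IsStarNormal U := isStarNormal_of_mem_unitary hU
  have hcont (f : ℂ → ℂ) : ContinuousOn f (spectrum ℂ U) := U.finite_spectrum.continuousOn f
  have hK' : Commute (star U) K := hK.units_inv_left (u := Unitary.toUnits ⟨U, hU⟩)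
  have hexp : ∀ z ∈ spectrum ℂ U, Complex.exp (Complex.I * z.arg) = z := fun z hz => by
    have hz1 : ‖z‖ = 1 := spectrum.norm_eq_one_of_unitary hU hz
    simpa [hz1, mul_comm] using Complex.norm_mul_exp_arg_mul_I z
  refine ⟨cfc (fun z : ℂ => (z.arg : ℂ)) U, ?_, hK.cfc hK' _, ?_⟩
  · rw [IsHermitian, ← star_eq_conjTranspose, ← cfc_star]
    simp
  · rw [← cfc_smul Complex.I _ U (hcont _), ← CFC.complex_exp_eq_normedSpace_exp,
      ← cfc_comp' _ _ U ((U.finite_spectrum.image _).continuousOn _) (hcont _)]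
    exact (cfc_congr hexp).trans (cfc_id' ℂ U)

theorem semiconjBy_aeval {R A : Type*} [CommSemiring R] [Semiring A] [Algebra R A] {x a b : A}
    (h : SemiconjBy x a b) (p : Polynomial R) : SemiconjBy x (p.aeval a) (p.aeval b) := by
  simp only [SemiconjBy, Polynomial.aeval_eq_sum_range, Finset.mul_sum, Finset.sum_mul,
    mul_smul_comm, smul_mul_assoc, (h.pow_right _).eq]

theorem exists_mem_spectrum_of_semiconjBy {𝕜 ι : Type*} [Field 𝕜] [IsAlgClosed 𝕜] [Fintype ι]
    [DecidableEq ι] {X A B : Matrix ι ι 𝕜} (hX : X ≠ 0) (h : SemiconjBy X A B) :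
    ∃ μ ∈ spectrum 𝕜 A, μ ∈ spectrum 𝕜 B := by
  have : Nontrivial (Matrix ι ι 𝕜) := nontrivial_of_ne X 0 hX
  have hzero : A.charpoly.aeval B * X = 0 := by
    rw [← (semiconjBy_aeval h A.charpoly).eq, aeval_self_charpoly, mul_zero]
  have hmem : (0 : 𝕜) ∈ spectrum 𝕜 (A.charpoly.aeval B) :=
    spectrum.zero_mem_iff 𝕜 |>.2 fun hunit => hX (hunit.mul_right_eq_zero.1 hzero)
  rw [spectrum.map_polynomial_aeval_of_nonempty _ _
    (spectrum.nonempty_of_isAlgClosed_of_finiteDimensional 𝕜 B)] at hmem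
  obtain ⟨μ, hμ, hroot⟩ := hmem
  exact ⟨μ, mem_spectrum_iff_isRoot_charpoly.2 hroot, hμ⟩

theorem exists_spectrum_sub_eq_of_lie_eq_smul {𝕜 ι : Type*} [Field 𝕜] [IsAlgClosed 𝕜] [Fintype ι]
    [DecidableEq ι] {A X : Matrix ι ι 𝕜} {x : 𝕜} (hX : X ≠ 0) (h : ⁅A, X⁆ = x • X) :
    ∃ μ ∈ spectrum 𝕜 A, ∃ ν ∈ spectrum 𝕜 A, μ - ν = x := by
  have hshift : SemiconjBy X (A + algebraMap 𝕜 _ x) A := by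
    rw [SemiconjBy, mul_add, ← Algebra.commutes, ← Algebra.smul_def, ← h, Ring.lie_def]
    abel
  obtain ⟨μ, hB, hA⟩ := exists_mem_spectrum_of_semiconjBy hX hshift
  rw [← spectrum.add_singleton_eq, Set.add_singleton] at hB
  obtain ⟨ν, hν, rfl⟩ := hB
  exact ⟨_, hA, ν, hν, by simp⟩

end CommutingMatrices

section BathOperations

variable {n : ℕ} {b : Type*} [Fintype b] [DecidableEq b] {HS : Matrix (Fin n) (Fin n) ℂ}
  {T : ℝ≥0∞}

open Matrix

/-- The maps generated at temperature `T` by a bath with Hamiltonian `HB` together with a unitary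
commuting with `H_S ⊗ 1 + 1 ⊗ H_B`. -/
def bathOperations (HS : Matrix (Fin n) (Fin n) ℂ) (T : ℝ≥0∞) (HB : Matrix b b ℂ) :
    Set (Matrix (Fin n) (Fin n) ℂ →L[ℂ] Matrix (Fin n) (Fin n) ℂ) :=
  {S | ∃ U ∈ unitaryGroup (Fin n × b) ℂ,
    Commute U (freeHamiltonian HS HB) ∧ S = thermalMap T HB U}

theorem commute_iff_conj_eq {ι : Type*} [Fintype ι] [DecidableEq ι] {U K : Matrix ι ι ℂ}
    (hU : U ∈ unitaryGroup ι ℂ) : Commute U K ↔ U * K * Uᴴ = K :=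
  (Units.mul_inv_eq_iff_eq_mul (Unitary.toUnits ⟨U, hU⟩)).symm

theorem mem_thermalOperations_iff
    {S : Matrix (Fin n) (Fin n) ℂ →L[ℂ] Matrix (Fin n) (Fin n) ℂ} :
    S ∈ thermalOperations HS T ↔ ∃ (m : ℕ) (HB : Matrix (Fin m) (Fin m) ℂ),
      0 < m ∧ HB.IsHermitian ∧ S ∈ bathOperations HS T HB := by
  constructor
  · rintro ⟨m, HB, U, hm, hHB, hU, hconj, rfl⟩
    exact ⟨m, HB, hm, hHB, U, hU, (commute_iff_conj_eq hU).2 hconj, rfl⟩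
  · rintro ⟨m, HB, hm, hHB, U, hU, hcomm, rfl⟩
    exact ⟨m, HB, U, hm, hHB, hU, (commute_iff_conj_eq hU).1 hcomm, rfl⟩

theorem exp_I_smul_mem_unitaryGroup {ι : Type*} [Fintype ι] [DecidableEq ι] {H : Matrix ι ι ℂ}
    (hH : H.IsHermitian) : NormedSpace.exp (Complex.I • H) ∈ unitaryGroup ι ℂ :=
  open scoped Matrix.Norms.L2Operator in
  (selfAdjoint.expUnitary ⟨H, hH⟩).2

theorem spinBathOperations_eq (HS : Matrix (Fin n) (Fin n) ℂ) (ΔE : ℝ) (T : ℝ≥0∞) {m : ℕ}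
    (β : Fin m → ℕ) :
    spinBathOperations HS ΔE T β = bathOperations HS T (spinHamiltonian ΔE β) := by
  ext S
  constructor
  · rintro ⟨H, hH, hcomm, rfl⟩
    exact ⟨_, exp_I_smul_mem_unitaryGroup hH,
      ((commute_iff_lie_eq.2 hcomm).smul_left _).exp_left, rfl⟩
  · rintro ⟨U, hU, hcomm, rfl⟩
    obtain ⟨H, hH, hHcomm, rfl⟩ := exists_isHermitian_exp_eq hU hcomm
    exact ⟨H, hH, commute_iff_lie_eq.1 hHcomm, rfl⟩

theorem partialTraceBath_mul_one_kronecker {s b : Type*} [Fintype s] [DecidableEq s] [Fintype b]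
    (X : Matrix (s × b) (s × b) ℂ) (V : Matrix b b ℂ) :
    partialTraceBath (X * (1 ⊗ₖ V)) = partialTraceBath ((1 ⊗ₖ V) * X) := by
  ext i j
  simp only [partialTraceBath, of_apply, mul_apply, Fintype.sum_prod_type, kronecker_apply,
    one_apply, ite_mul, mul_ite, one_mul, zero_mul, mul_zero, Finset.sum_ite_irrel,
    Finset.sum_const_zero, Finset.sum_ite_eq, Finset.sum_ite_eq', Finset.mem_univ, if_true]
  rw [Finset.sum_comm]
  simp only [mul_comm]

theorem gibbsState_conj (t : ℝ) (H : Matrix b b ℂ) {V : Matrix b b ℂ} (hV : V ∈ unitaryGroup b ℂ) :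
    gibbsState t (V * H * Vᴴ) = V * gibbsState t H * Vᴴ := by
  have hVl : Vᴴ * V = 1 := mem_unitaryGroup_iff'.1 hV
  have hVinv : Vᴴ = V⁻¹ := (inv_eq_left_inv hVl).symm
  have hexp : NormedSpace.exp (-(t⁻¹ • (V * H * Vᴴ))) =
      V * NormedSpace.exp (-(t⁻¹ • H)) * Vᴴ := by
    rw [hVinv, ← exp_conj V _ (IsUnit.of_mul_eq_one_right _ hVl)]
    simp
  rw [gibbsState, hexp, trace_mul_cycle, hVl, one_mul, gibbsState, mul_smul_comm, smul_mul_assoc]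

theorem gibbsState_one (H : Matrix b b ℂ) : gibbsState 1 (1 : Matrix b b ℂ) = gibbsState 0 H := by
  have hexp : NormedSpace.exp (-((1 : ℝ)⁻¹ • (1 : Matrix b b ℂ))) = Complex.exp (-1) • 1 := by
    rw [← diagonal_one, ← diagonal_smul, diagonal_neg, exp_diagonal, ← diagonal_smul]
    congr 1
    funext k
    simp [Pi.coe_exp, Complex.exp_eq_exp_ℂ]
  rw [gibbsState, hexp, gibbsState]
  simp [smul_smul]

-- At `T = ⊤` the right-hand side has temperature `0`, and `0⁻¹ = 0` turns that Gibbs state into the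
-- maximally mixed one.
theorem thermalMap_apply (T : ℝ≥0∞) (HB : Matrix b b ℂ) (U : Matrix (Fin n × b) (Fin n × b) ℂ)
    (A : Matrix (Fin n) (Fin n) ℂ) :
    thermalMap T HB U A = partialTraceBath (U * (A ⊗ₖ gibbsState T.toReal HB) * Uᴴ) := by
  by_cases hT : T = ⊤
  · simp only [thermalMap, hT, if_true, ENNReal.toReal_top, ← gibbsState_one HB]
    rfl
  · simp only [thermalMap, hT, if_false]
    rfl

theorem thermalMap_conj (T : ℝ≥0∞) (HB : Matrix b b ℂ) {V : Matrix b b ℂ}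
    (hV : V ∈ unitaryGroup b ℂ) (U : Matrix (Fin n × b) (Fin n × b) ℂ) :
    thermalMap T (V * HB * Vᴴ) U = thermalMap T HB ((1 ⊗ₖ V)ᴴ * U * (1 ⊗ₖ V)) := by
  have hW : (1 ⊗ₖ V : Matrix (Fin n × b) (Fin n × b) ℂ) * (1 ⊗ₖ V)ᴴ = 1 :=
    mem_unitaryGroup_iff.1 (kronecker_mem_unitary (one_mem _) hV)
  ext1 A
  set W : Matrix (Fin n × b) (Fin n × b) ℂ := 1 ⊗ₖ V
  have hgibbs : A ⊗ₖ gibbsState T.toReal (V * HB * Vᴴ) =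
      W * (A ⊗ₖ gibbsState T.toReal HB) * Wᴴ := by
    rw [gibbsState_conj _ _ hV, conjTranspose_kronecker, ← mul_kronecker_mul,
      ← mul_kronecker_mul, conjTranspose_one, one_mul, mul_one]
  set G := A ⊗ₖ gibbsState T.toReal HB
  calc thermalMap T (V * HB * Vᴴ) U A
      = partialTraceBath (W * Wᴴ * (U * (W * G * Wᴴ) * Uᴴ)) := by
        rw [hW, one_mul, thermalMap_apply, hgibbs]
    _ = partialTraceBath (Wᴴ * (U * (W * G * Wᴴ) * Uᴴ) * W) := by
        rw [partialTraceBath_mul_one_kronecker, mul_assoc]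
    _ = thermalMap T HB (Wᴴ * U * W) A := by
        rw [thermalMap_apply, conjTranspose_mul, conjTranspose_mul, conjTranspose_conjTranspose]
        simp only [G, mul_assoc]

theorem freeHamiltonian_conj (HS : Matrix (Fin n) (Fin n) ℂ) (HB : Matrix b b ℂ)
    {V : Matrix b b ℂ} (hV : V ∈ unitaryGroup b ℂ) :
    freeHamiltonian HS (V * HB * Vᴴ) =
      (1 ⊗ₖ V) * freeHamiltonian HS HB * (1 ⊗ₖ V)ᴴ := by
  have hVr : V * Vᴴ = 1 := mem_unitaryGroup_iff.1 hV
  simp only [freeHamiltonian, conjTranspose_kronecker, Matrix.mul_add, Matrix.add_mul,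
    ← mul_kronecker_mul, conjTranspose_one, one_mul, mul_one, hVr]

theorem bathOperations_conj_subset (HS : Matrix (Fin n) (Fin n) ℂ) (T : ℝ≥0∞) (HB : Matrix b b ℂ)
    {V : Matrix b b ℂ} (hV : V ∈ unitaryGroup b ℂ) :
    bathOperations HS T (V * HB * Vᴴ) ⊆ bathOperations HS T HB := by
  rintro S ⟨U, hU, hcomm, rfl⟩
  have hW : (1 ⊗ₖ V : Matrix (Fin n × b) (Fin n × b) ℂ) ∈ unitaryGroup (Fin n × b) ℂ :=
    kronecker_mem_unitary (one_mem _) hV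
  let Φ := Unitary.conjStarAlgAut ℂ _ ⟨_, hW⟩
  have hcomm' : Commute U (Φ (freeHamiltonian HS HB)) := by
    rwa [freeHamiltonian_conj HS HB hV] at hcomm
  refine ⟨_, mul_mem (mul_mem (Unitary.star_mem hW) hU) hW, ?_, thermalMap_conj T HB hV U⟩
  simpa only [StarAlgEquiv.symm_apply_apply] using! hcomm'.map Φ.symm

end BathOperations

section Kraus

open Filter Matrix Topology

variable {s b c : Type*} [Fintype s] [Fintype b] [Fintype c]

/-- The matrix on `ℂˢ ⊗ ℂᵇ` with a given `b × b` array of `s × s` blocks; `Matrix.comp` puts the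
array index first, whereas the bath is the second tensor factor. -/
def ofBlocks [DecidableEq s] [DecidableEq b] :
    Matrix b b (Matrix s s ℂ) ≃⋆ₐ[ℂ] Matrix (s × b) (s × b) ℂ :=
  StarAlgEquiv.ofAlgEquiv
    ((compAlgEquiv b s ℂ ℂ).trans (reindexAlgEquiv ℂ ℂ (Equiv.prodComm b s))) fun _ => rfl

theorem ofBlocks_apply [DecidableEq s] [DecidableEq b] (B : Matrix b b (Matrix s s ℂ))
    (p q : s × b) : ofBlocks B p q = B p.2 q.2 p.1 q.1 := rfl

theorem ofBlocks_mem_unitaryGroup_iff [DecidableEq s] [DecidableEq b]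
    {B : Matrix b b (Matrix s s ℂ)} :
    ofBlocks B ∈ unitaryGroup (s × b) ℂ ↔ B * Bᴴ = 1 := by
  rw [mem_unitaryGroup_iff, ← map_star, ← map_mul, EmbeddingLike.map_eq_one_iff,
    star_eq_conjTranspose]

theorem partialTraceBath_ofBlocks [DecidableEq s] [DecidableEq b]
    (B : Matrix b b (Matrix s s ℂ)) :
    partialTraceBath (ofBlocks B) = B.trace := by
  ext i j
  simp [partialTraceBath, ofBlocks_apply, trace, Matrix.sum_apply]

theorem ofBlocks_diagonal_smul [DecidableEq s] [DecidableEq b] (A : Matrix s s ℂ)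
    (w : b → ℂ) : ofBlocks (diagonal fun k => w k • A) = A ⊗ₖ diagonal w := by
  ext ⟨i, l⟩ ⟨j, k⟩
  by_cases h : l = k <;> simp [ofBlocks_apply, h, mul_comm]

theorem ofBlocks_diagonal_add {n : ℕ} [DecidableEq b] (HS : Matrix (Fin n) (Fin n) ℂ)
    (e : b → ℝ) : ofBlocks (diagonal fun k => HS + e k • 1) =
      freeHamiltonian HS (diagonal fun k => (e k : ℂ)) := by
  ext ⟨i, l⟩ ⟨j, k⟩
  by_cases h : l = k <;> simp [freeHamiltonian, ofBlocks_apply, h, one_apply]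

/-- The map `A ↦ ∑ l, B l k * A * (B l k)ᴴ`, whose Kraus operators are the blocks in column `k`;
the bath starts in its `k`-th level. -/
noncomputable def krausMap (B : Matrix b b (Matrix s s ℂ)) (k : b) :
    Matrix s s ℂ →L[ℂ] Matrix s s ℂ :=
  LinearMap.toContinuousLinearMap (∑ l, LinearMap.mulLeftRight ℂ (B l k, (B l k)ᴴ))

theorem krausMap_apply (B : Matrix b b (Matrix s s ℂ)) (k : b) (A : Matrix s s ℂ) :
    krausMap B k A = ∑ l, B l k * A * (B l k)ᴴ := by
  simp [krausMap]

/-- The mixture of the maps `krausMap B k` with probabilities proportional to `w k`. -/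
noncomputable def krausMixture (w : b → ℝ) (B : Matrix b b (Matrix s s ℂ)) :
    Matrix s s ℂ →L[ℂ] Matrix s s ℂ :=
  ∑ k, ((w k / ∑ l, w l : ℝ) : ℂ) • krausMap B k

theorem krausMixture_smul {z : ℝ} (hz : z ≠ 0) (w : b → ℝ) (B : Matrix b b (Matrix s s ℂ)) :
    krausMixture (z • w) B = krausMixture w B := by
  simp only [krausMixture, Pi.smul_apply, smul_eq_mul, ← Finset.mul_sum, mul_div_mul_left _ _ hz]

theorem krausMixture_submatrix_equiv (σ : c ≃ b) (w : b → ℝ) (B : Matrix b b (Matrix s s ℂ)) :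
    krausMixture (w ∘ σ) (B.submatrix σ σ) = krausMixture w B := by
  have hcol (k : c) : krausMap (B.submatrix σ σ) k = krausMap B (σ k) := by
    ext1 A
    simp only [krausMap_apply, submatrix_apply]
    exact σ.sum_comp fun l => B l (σ k) * A * (B l (σ k))ᴴ
  simp only [krausMixture, hcol, Function.comp_apply, σ.sum_comp w]
  exact σ.sum_comp fun k => ((w k / ∑ l, w l : ℝ) : ℂ) • krausMap B k

theorem krausMixture_fromBlocks (w : b → ℝ) (B : Matrix b b (Matrix s s ℂ))
    (D : Matrix c c (Matrix s s ℂ)) :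
    krausMixture (Sum.elim w 0) (fromBlocks B 0 0 D) = krausMixture w B := by
  have hcol (k : b) : krausMap (fromBlocks B 0 0 D) (.inl k) = krausMap B k := by
    ext1 A
    simp [krausMap_apply, Fintype.sum_sum_type]
  ext1 A
  simp [krausMixture, Fintype.sum_sum_type, hcol]

theorem tendsto_krausMixture {ι : Type*} {F : Filter ι} {w : ι → b → ℝ} {w₀ : b → ℝ}
    (hw : Tendsto w F (𝓝 w₀)) (hw₀ : ∑ k, w₀ k ≠ 0) (B : Matrix b b (Matrix s s ℂ)) :
    Tendsto (fun i => krausMixture (w i) B) F (𝓝 (krausMixture w₀ B)) := by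
  have hw' := tendsto_pi_nhds.1 hw
  refine tendsto_finsetSum _ fun k _ => Tendsto.smul_const ?_ _
  exact (Complex.continuous_ofReal.tendsto _).comp
    ((hw' k).div (tendsto_finsetSum _ fun l _ => hw' l) hw₀)

/-- The blocks obtained from `B` when the bath level `k` is replaced by `N k` copies of it, the
`x`-th copies of all levels interacting among each other only. -/
def amplify (N : b → ℕ) (B : Matrix b b (Matrix s s ℂ)) :
    Matrix (Σ k, Fin (N k)) (Σ k, Fin (N k)) (Matrix s s ℂ) :=
  of fun l k => if (l.2 : ℕ) = k.2 then B l.1 k.1 else 0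

theorem sum_sigma_fin_ite_eq {R : Type*} [AddCommMonoid R] {N : b → ℕ} (k : Σ k, Fin (N k))
    (f : b → R) (hf : ∀ l, f l ≠ 0 → N l = N k.1) :
    ∑ l : Σ l, Fin (N l), (if (l.2 : ℕ) = k.2 then f l.1 else 0) = ∑ l, f l := by
  rw [Fintype.sum_sigma]
  refine Finset.sum_congr rfl fun l _ => ?_
  by_cases hl : f l = 0
  · simp [hl]
  · have hlt : (k.2 : ℕ) < N l := (hf l hl).symm ▸ k.2.2
    simpa [Fin.ext_iff] using Fintype.sum_ite_eq' (⟨k.2, hlt⟩ : Fin (N l)) fun _ => f l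

theorem amplify_mul_conjTranspose [DecidableEq s] [DecidableEq b] {N : b → ℕ}
    {B : Matrix b b (Matrix s s ℂ)} (hN : ∀ l k, B l k ≠ 0 → N l = N k) (hB : B * Bᴴ = 1) :
    amplify N B * (amplify N B)ᴴ = 1 := by
  ext1 l k
  have hsum : (amplify N B * (amplify N B)ᴴ) l k =
      if (l.2 : ℕ) = k.2 then (B * Bᴴ) l.1 k.1 else 0 := by
    have hterm (m : Σ m, Fin (N m)) : amplify N B l m * (amplify N B)ᴴ m k =
        if (m.2 : ℕ) = l.2 then
          (if (l.2 : ℕ) = k.2 then B l.1 m.1 * (B k.1 m.1)ᴴ else 0) else 0 := by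
      rw [conjTranspose_apply, amplify, of_apply, of_apply, star_eq_conjTranspose, eq_comm]
      by_cases hm : (m.2 : ℕ) = l.2
      · by_cases hlk : (l.2 : ℕ) = k.2 <;> simp [hm, hlk, eq_comm]
      · simp [hm, Ne.symm hm]
    simp only [mul_apply, hterm]
    rw [sum_sigma_fin_ite_eq l fun m => if (l.2 : ℕ) = k.2 then B l.1 m * (B k.1 m)ᴴ else 0]
    · split_ifs <;> simp [star_eq_conjTranspose]
    · intro m hm
      refine (hN l.1 m fun h => hm ?_).symm
      simp [h]
  have hone : l = k ↔ (l.2 : ℕ) = k.2 ∧ l.1 = k.1 := by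
    obtain ⟨l, x⟩ := l
    obtain ⟨k, y⟩ := k
    constructor
    · rintro ⟨⟩
      exact ⟨rfl, rfl⟩
    · rintro ⟨hxy, rfl : l = k⟩
      exact congrArg (Sigma.mk l) (Fin.ext hxy)
  simp only [hsum, hB, one_apply, hone, ite_and]

theorem krausMixture_amplify {N : b → ℕ} {B : Matrix b b (Matrix s s ℂ)}
    (hN : ∀ l k, B l k ≠ 0 → N l = N k) (w : b → ℝ) :
    krausMixture (fun k : Σ k, Fin (N k) => w k.1) (amplify N B) =
      krausMixture (fun k => N k * w k) B := by
  have hcol (k : Σ k, Fin (N k)) : krausMap (amplify N B) k = krausMap B k.1 := by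
    ext1 A
    rw [krausMap_apply, krausMap_apply,
      ← sum_sigma_fin_ite_eq k fun l => B l k.1 * A * (B l k.1)ᴴ]
    · refine Finset.sum_congr rfl fun l _ => ?_
      simp only [amplify, of_apply]
      split_ifs <;> simp
    · intro l hl
      refine hN l k.1 fun h => hl ?_
      simp [h]
  simp only [krausMixture, hcol, Fintype.sum_sigma, Finset.sum_const, Finset.card_univ,
    Fintype.card_fin, ← Nat.cast_smul_eq_nsmul ℂ, smul_smul, nsmul_eq_mul, mul_div_assoc,
    Complex.ofReal_mul, Complex.ofReal_natCast]

end Kraus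

section DiagonalBath

open Matrix

variable {n : ℕ} {b c : Type*} [Fintype b] [DecidableEq b] [Fintype c] [DecidableEq c]
  {HS : Matrix (Fin n) (Fin n) ℂ} {T : ℝ≥0∞} {e : b → ℝ}
  {B : Matrix b b (Matrix (Fin n) (Fin n) ℂ)}

/-- The unnormalised Boltzmann weights of the energies `e` at temperature `t`; since `0⁻¹ = 0`, the
value `t = 0 = (⊤ : ℝ≥0∞).toReal` encodes infinite temperature. -/
noncomputable def boltzmann {b : Type*} (t : ℝ) (e : b → ℝ) (k : b) : ℝ :=
  Real.exp (-(t⁻¹ * e k))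

theorem sum_boltzmann_pos {b : Type*} [Fintype b] [Nonempty b] (t : ℝ) (e : b → ℝ) :
    0 < ∑ k, boltzmann t e k :=
  Finset.sum_pos (fun _ _ => Real.exp_pos _) Finset.univ_nonempty

theorem gibbsState_diagonal (t : ℝ) (e : b → ℝ) :
    gibbsState t (diagonal fun k => (e k : ℂ)) =
      diagonal fun k => ((boltzmann t e k / ∑ l, boltzmann t e l : ℝ) : ℂ) := by
  have hexp : NormedSpace.exp (-(t⁻¹ • diagonal fun k => (e k : ℂ))) =
      diagonal fun k => (boltzmann t e k : ℂ) := by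
    rw [← diagonal_smul, diagonal_neg, exp_diagonal]
    congr 1
    funext k
    simp [Pi.coe_exp, ← Complex.exp_eq_exp_ℂ, boltzmann]
  rw [gibbsState, hexp, trace_diagonal, ← diagonal_smul]
  congr 1
  funext k
  simp [div_eq_inv_mul]

theorem thermalMap_diagonal (T : ℝ≥0∞) (e : b → ℝ) (B : Matrix b b (Matrix (Fin n) (Fin n) ℂ)) :
    thermalMap T (diagonal fun k => (e k : ℂ)) (ofBlocks B) =
      krausMixture (boltzmann T.toReal e) B := by
  ext1 A
  rw [thermalMap_apply, gibbsState_diagonal, ← ofBlocks_diagonal_smul, ← star_eq_conjTranspose,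
    ← map_star, ← map_mul, ← map_mul, partialTraceBath_ofBlocks, krausMixture, _root_.sum_apply]
  set w : b → ℝ := fun k => boltzmann T.toReal e k / ∑ l, boltzmann T.toReal e l
  calc (B * diagonal (fun k => (w k : ℂ) • A) * star B).trace
      = ∑ l, ∑ k, (B * diagonal fun k => (w k : ℂ) • A) l k * (B l k)ᴴ := rfl
    _ = ∑ k, ∑ l, (w k : ℂ) • (B l k * A * (B l k)ᴴ) := by
        rw [Finset.sum_comm]
        simp only [mul_diagonal, Matrix.mul_smul, Matrix.smul_mul]
    _ = ∑ k, ((w k : ℂ) • krausMap B k) A := by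
        simp only [_root_.smul_apply, krausMap_apply, Finset.smul_sum]

/-- The blocks of a unitary on `ℂⁿ ⊗ ℂᵇ` which commutes with `H_S ⊗ 1 + 1 ⊗ diag e`: the block
leading from the bath level `k` to the bath level `l` shifts the system energy by `e k - e l`. -/
structure IsEnergyConserving (HS : Matrix (Fin n) (Fin n) ℂ) (e : b → ℝ)
    (B : Matrix b b (Matrix (Fin n) (Fin n) ℂ)) : Prop where
  mul_conjTranspose : B * Bᴴ = 1
  lie : ∀ l k, ⁅HS, B l k⁆ = ((e k - e l : ℝ) : ℂ) • B l k

theorem commute_ofBlocks_freeHamiltonian_iff :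
    Commute (ofBlocks B) (freeHamiltonian HS (diagonal fun k => (e k : ℂ))) ↔
      ∀ l k, ⁅HS, B l k⁆ = ((e k - e l : ℝ) : ℂ) • B l k := by
  rw [← ofBlocks_diagonal_add, commute_map_iff (EquivLike.injective ofBlocks), commute_iff_eq,
    ← ext_iff]
  refine forall₂_congr fun l k => ?_
  have hlie : (HS + e l • 1) * B l k - B l k * (HS + e k • 1) =
      ⁅HS, B l k⁆ - ((e k - e l : ℝ) : ℂ) • B l k := by
    simp only [add_mul, mul_add, smul_mul_assoc, mul_smul_comm, one_mul, mul_one, Ring.lie_def,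
      Complex.coe_smul, sub_smul]
    abel
  rw [mul_diagonal, diagonal_mul, eq_comm, ← sub_eq_zero, hlie, sub_eq_zero]

theorem mem_bathOperations_diagonal_iff
    {S : Matrix (Fin n) (Fin n) ℂ →L[ℂ] Matrix (Fin n) (Fin n) ℂ} :
    S ∈ bathOperations HS T (diagonal fun k => (e k : ℂ)) ↔
      ∃ B, IsEnergyConserving HS e B ∧ S = krausMixture (boltzmann T.toReal e) B := by
  simp only [bathOperations, Set.mem_ofPred_eq, ← thermalMap_diagonal]
  constructor
  · rintro ⟨U, hU, hcomm, rfl⟩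
    obtain ⟨B, rfl⟩ := ofBlocks.surjective U
    exact ⟨B, ⟨ofBlocks_mem_unitaryGroup_iff.1 hU,
      commute_ofBlocks_freeHamiltonian_iff.1 hcomm⟩, rfl⟩
  · rintro ⟨B, hB, rfl⟩
    exact ⟨_, ofBlocks_mem_unitaryGroup_iff.2 hB.mul_conjTranspose,
      commute_ofBlocks_freeHamiltonian_iff.2 hB.lie, rfl⟩

theorem IsEnergyConserving.submatrix_equiv (hB : IsEnergyConserving HS e B) (σ : c ≃ b) :
    IsEnergyConserving HS (e ∘ σ) (B.submatrix σ σ) where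
  mul_conjTranspose := by
    rw [conjTranspose_submatrix, submatrix_mul_equiv, hB.mul_conjTranspose, submatrix_one_equiv]
  lie l k := hB.lie (σ l) (σ k)

theorem IsEnergyConserving.fromBlocks_one (hB : IsEnergyConserving HS e B) (e' : c → ℝ) :
    IsEnergyConserving HS (Sum.elim e e') (fromBlocks B 0 0 1) where
  mul_conjTranspose := by
    simp [fromBlocks_conjTranspose, fromBlocks_multiply, hB.mul_conjTranspose]
  lie := by
    rintro (l | l) (k | k)
    · exact hB.lie l k
    · simp [Ring.lie_def]
    · simp [Ring.lie_def]
    · by_cases h : l = k <;> simp [h, Ring.lie_def]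

protected theorem IsEnergyConserving.amplify (hB : IsEnergyConserving HS e B) {N : b → ℕ}
    (hN : ∀ l k, B l k ≠ 0 → N l = N k) :
    IsEnergyConserving HS (fun k : Σ k, Fin (N k) => e k.1) (amplify N B) where
  mul_conjTranspose := amplify_mul_conjTranspose hN hB.mul_conjTranspose
  lie l k := by
    by_cases h : (l.2 : ℕ) = k.2
    · simpa [amplify, h] using hB.lie l.1 k.1
    · simp [amplify, h, Ring.lie_def]

theorem bathOperations_diagonal_subset_comp_equiv (σ : c ≃ b) :
    bathOperations HS T (diagonal fun k => (e k : ℂ)) ⊆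
      bathOperations HS T (diagonal fun k => (e (σ k) : ℂ)) := by
  intro S hS
  obtain ⟨B, hB, rfl⟩ := mem_bathOperations_diagonal_iff.1 hS
  exact mem_bathOperations_diagonal_iff.2
    ⟨_, hB.submatrix_equiv σ, (krausMixture_submatrix_equiv σ _ B).symm⟩

end DiagonalBath

section SpinBath

open Filter Matrix Topology

variable {n : ℕ} {b : Type*} [Fintype b] [DecidableEq b] {HS : Matrix (Fin n) (Fin n) ℂ}
  {ΔE : ℝ} {T : ℝ≥0∞}

/-- The energy of the levels with index `j` of a spin bath; as in `spinHamiltonian`, the index `j`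
stands for `j + 1`. -/
def rung (ΔE : ℝ) (j : ℕ) : ℝ := (j + 1) * ΔE

theorem spinHamiltonian_eq_diagonal (ΔE : ℝ) {m : ℕ} (β : Fin m → ℕ) :
    spinHamiltonian ΔE β = diagonal fun k => ((rung ΔE k.1 : ℝ) : ℂ) := by
  refine (congrArg blockDiagonal' (funext fun j => ?_)).trans
    (blockDiagonal'_diagonal fun j (_ : Fin (β j)) => (rung ΔE j : ℂ))
  rw [← diagonal_one, ← diagonal_smul]
  congr 1
  funext k
  simp [rung]

theorem spinBathOperations_eq_diagonal (HS : Matrix (Fin n) (Fin n) ℂ) (ΔE : ℝ) (T : ℝ≥0∞) {m : ℕ}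
    (β : Fin m → ℕ) : spinBathOperations HS ΔE T β =
      bathOperations HS T (diagonal fun k : Σ j, Fin (β j) => (rung ΔE k.1 : ℂ)) := by
  rw [spinBathOperations_eq, spinHamiltonian_eq_diagonal]

theorem bathOperations_rung_subset_spinBathOperations {m : ℕ} (E : b → Fin m) :
    bathOperations HS T (diagonal fun k => (rung ΔE (E k) : ℂ)) ⊆
      spinBathOperations HS ΔE T fun j => Fintype.card {k // E k = j} := by
  let σ : (Σ j, Fin (Fintype.card {k // E k = j})) ≃ b :=
    (Equiv.sigmaCongrRight fun _ => (Fintype.equivFin _).symm).trans (Equiv.sigmaFiberEquiv E)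
  have hσ (k) : E (σ k) = k.1 := ((Fintype.equivFin {l // E l = k.1}).symm k.2).2
  rw [spinBathOperations_eq_diagonal]
  simpa only [hσ] using bathOperations_diagonal_subset_comp_equiv σ
    (HS := HS) (T := T) (e := fun k => rung ΔE (E k))

theorem bathOperations_rung_subset_spinThermalOperations {m : ℕ} (hm : 0 < m) {E : b → Fin m}
    (hE : Function.Surjective E) :
    bathOperations HS T (diagonal fun k => (rung ΔE (E k) : ℂ)) ⊆ spinThermalOperations HS ΔE T :=
  fun _ hS => ⟨m, _, hm, fun j => Fintype.card_pos_iff.2 (let ⟨k, hk⟩ := hE j; ⟨k, hk⟩),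
    bathOperations_rung_subset_spinBathOperations E hS⟩

theorem bathOperations_rung_subset_spinThermalOperationsWithGaps [Nonempty b] (E : b → ℕ) :
    bathOperations HS T (diagonal fun k => (rung ΔE (E k) : ℂ)) ⊆
      spinThermalOperationsWithGaps HS ΔE T := by
  intro S hS
  obtain ⟨m, hm⟩ := (Set.finite_range E).bddAbove
  let E' (k : b) : Fin (m + 1) := ⟨E k, Nat.lt_succ_of_le (hm ⟨k, rfl⟩)⟩
  refine ⟨m + 1, _, m.succ_pos, ?_, bathOperations_rung_subset_spinBathOperations E' hS⟩
  obtain ⟨k⟩ := ‹Nonempty b›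
  exact Finset.sum_pos' (fun _ _ => Nat.zero_le _)
    ⟨E' k, Finset.mem_univ _, Fintype.card_pos_iff.2 ⟨k, rfl⟩⟩

theorem spinThermalOperations_subset_withGaps (HS : Matrix (Fin n) (Fin n) ℂ) (ΔE : ℝ)
    (T : ℝ≥0∞) : spinThermalOperations HS ΔE T ⊆ spinThermalOperationsWithGaps HS ΔE T := by
  rintro S ⟨m, β, hm, hβ, hS⟩
  exact ⟨m, β, hm, Finset.sum_pos (fun j _ => hβ j) ⟨⟨0, hm⟩, Finset.mem_univ _⟩, hS⟩

theorem spinThermalOperationsWithGaps_subset_thermalOperations (HS : Matrix (Fin n) (Fin n) ℂ)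
    (ΔE : ℝ) (T : ℝ≥0∞) :
    spinThermalOperationsWithGaps HS ΔE T ⊆ thermalOperations HS T := by
  rintro S ⟨m, β, -, hβ, hS⟩
  rw [spinBathOperations_eq_diagonal] at hS
  refine mem_thermalOperations_iff.2 ⟨_, _, ?_, ?_,
    bathOperations_diagonal_subset_comp_equiv (Fintype.equivFin _).symm hS⟩
  · simpa using hβ
  · exact isHermitian_diagonal_iff.2 fun k => Complex.conj_ofReal _

theorem krausMixture_mem_closure
    {𝒮 : Set (Matrix (Fin n) (Fin n) ℂ →L[ℂ] Matrix (Fin n) (Fin n) ℂ)} {e x : b → ℝ}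
    {B : Matrix b b (Matrix (Fin n) (Fin n) ℂ)} (hB : IsEnergyConserving HS e B) {N : ℕ → b → ℕ}
    (hN : ∀ M l k, B l k ≠ 0 → N M l = N M k)
    (hlim : ∀ k, Tendsto (fun M => (N M k : ℝ) / M) atTop (𝓝 (x k)))
    (hx : ∑ k, x k * boltzmann T.toReal e k ≠ 0)
    (h𝒮 : ∀ᶠ M in atTop,
      bathOperations HS T (diagonal fun k : Σ k, Fin (N M k) => (e k.1 : ℂ)) ⊆ 𝒮) :
    krausMixture (fun k => x k * boltzmann T.toReal e k) B ∈ closure 𝒮 := by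
  have hw : Tendsto (fun (M : ℕ) k => (N M k : ℝ) / M * boltzmann T.toReal e k) atTop
      (𝓝 fun k => x k * boltzmann T.toReal e k) :=
    tendsto_pi_nhds.2 fun k => (hlim k).mul_const _
  refine mem_closure_of_tendsto (tendsto_krausMixture hw hx B) ?_
  filter_upwards [h𝒮, eventually_ne_atTop 0] with M hM hM0
  refine hM (mem_bathOperations_diagonal_iff.2 ⟨_, hB.amplify (hN M), ?_⟩)
  refine Eq.trans ?_ (krausMixture_amplify (hN M) (boltzmann T.toReal e)).symm
  rw [← krausMixture_smul (Nat.cast_ne_zero.2 hM0)]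
  congr 1
  funext k
  have : (M : ℝ) ≠ 0 := Nat.cast_ne_zero.2 hM0
  simp only [Pi.smul_apply, smul_eq_mul]
  field_simp

theorem spinThermalOperationsWithGaps_subset_closure (HS : Matrix (Fin n) (Fin n) ℂ) (ΔE : ℝ)
    (T : ℝ≥0∞) :
    spinThermalOperationsWithGaps HS ΔE T ⊆ closure (spinThermalOperations HS ΔE T) := by
  rintro S ⟨m, β, hm, hβ, hS⟩
  rw [spinBathOperations_eq_diagonal] at hS
  obtain ⟨B, hB, rfl⟩ := mem_bathOperations_diagonal_iff.1 hS
  have : Nonempty (Σ j, Fin (β j)) := Fintype.card_pos_iff.1 (by simpa using hβ)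
  let e : (Σ j, Fin (β j)) ⊕ Fin m → ℝ := Sum.elim (fun k => rung ΔE k.1) fun j => rung ΔE j
  let N (M : ℕ) : (Σ j, Fin (β j)) ⊕ Fin m → ℕ := Sum.elim (fun _ => M) fun _ => 1
  let x : (Σ j, Fin (β j)) ⊕ Fin m → ℝ := Sum.elim 1 0
  have hx : (fun k => x k * boltzmann T.toReal e k) =
      Sum.elim (boltzmann T.toReal fun k : Σ j, Fin (β j) => rung ΔE k.1) 0 := by
    funext k
    rcases k with k | j <;> simp [x, e, boltzmann]
  rw [← krausMixture_fromBlocks _ B (1 : Matrix (Fin m) (Fin m) (Matrix (Fin n) (Fin n) ℂ)), ← hx]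
  refine krausMixture_mem_closure (hB.fromBlocks_one _) (N := N) ?_ ?_ ?_ ?_
  · rintro M (l | l) (k | k) <;> simp [N]
  · rintro (k | j)
    · exact tendsto_const_nhds.congr' ((eventually_ne_atTop 0).mono fun M hM =>
        (div_self (Nat.cast_ne_zero.2 hM)).symm)
    · simpa [N, x] using tendsto_inv_atTop_nhds_zero_nat (𝕜 := ℝ)
  · simpa [hx] using! (sum_boltzmann_pos T.toReal _).ne'
  · refine Eventually.of_forall fun M => ?_
    let E (k : Σ k, Fin (N M k)) : Fin m := Sum.elim Sigma.fst id k.1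
    have hE : Function.Surjective E := fun j => ⟨⟨.inr j, (0 : Fin 1)⟩, rfl⟩
    convert bathOperations_rung_subset_spinThermalOperations hm hE using 4 with k
    rcases k with ⟨k | j, y⟩ <;> rfl

theorem exists_eq_add_rung {ι : Type*} [Finite ι] (ΔE : ℝ) (e : ι → ℝ) :
    ∃ (E : ι → ℕ) (r : ι → ℝ), (∀ k, e k = r k + rung ΔE (E k)) ∧
      ∀ l k, e k - e l ∈ AddSubgroup.zmultiples ΔE → r l = r k := by
  let r₀ (k : ι) : ℝ := (e k : ℝ ⧸ AddSubgroup.zmultiples ΔE).out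
  have hr₀ (k : ι) : ∃ z : ℤ, z • ΔE = -r₀ k + e k :=
    AddSubgroup.mem_zmultiples_iff.1 (QuotientAddGroup.eq.1 (QuotientAddGroup.out_eq' _))
  choose z hz using hr₀
  obtain ⟨z₀, hz₀⟩ := (Set.finite_range z).bddBelow
  refine ⟨fun k => (z k - z₀).toNat, fun k => r₀ k + (z₀ - 1) * ΔE, fun k => ?_, fun l k h => ?_⟩
  · have hcast : ((z k - z₀).toNat : ℝ) = z k - z₀ := by
      exact_mod_cast Int.toNat_of_nonneg (sub_nonneg.2 (hz₀ ⟨k, rfl⟩))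
    have := hz k
    rw [zsmul_eq_mul] at this
    rw [rung, hcast]
    linarith
  · have hclass : (e l : ℝ ⧸ AddSubgroup.zmultiples ΔE) = e k :=
      QuotientAddGroup.eq.2 (by rwa [neg_add_eq_sub])
    simp only [r₀, hclass]

theorem IsEnergyConserving.sub_mem_zmultiples
    (hσ : ∀ μ ∈ spectrum ℂ HS, ∀ ν ∈ spectrum ℂ HS, μ - ν ∈ AddSubgroup.zmultiples (ΔE : ℂ))
    {e : b → ℝ} {B : Matrix b b (Matrix (Fin n) (Fin n) ℂ)} (hB : IsEnergyConserving HS e B)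
    {l k : b} (hlk : B l k ≠ 0) : e k - e l ∈ AddSubgroup.zmultiples ΔE := by
  obtain ⟨μ, hμ, ν, hν, hgap⟩ := exists_spectrum_sub_eq_of_lie_eq_smul hlk (hB.lie l k)
  obtain ⟨z, hz : z • (ΔE : ℂ) = μ - ν⟩ := hσ μ hμ ν hν
  exact ⟨z, Complex.ofReal_injective (by simpa [hgap] using hz)⟩

theorem IsEnergyConserving.krausMixture_mem_closure_withGaps [Nonempty b] {E : b → ℕ}
    {B : Matrix b b (Matrix (Fin n) (Fin n) ℂ)}
    (hB : IsEnergyConserving HS (fun k => rung ΔE (E k)) B) {x : b → ℝ} (hx : ∀ k, 0 < x k)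
    (hxB : ∀ l k, B l k ≠ 0 → x l = x k) :
    krausMixture (fun k => x k * boltzmann T.toReal (fun k => rung ΔE (E k)) k) B ∈
      closure (spinThermalOperationsWithGaps HS ΔE T) := by
  refine krausMixture_mem_closure hB (N := fun M k => ⌈x k * M⌉₊) ?_ ?_ ?_ ?_
  · intro M l k hlk
    simp only [hxB l k hlk]
  · exact fun k => (tendsto_nat_ceil_mul_div_atTop (hx k).le).comp tendsto_natCast_atTop_atTop
  · exact (Finset.sum_pos (fun k _ => mul_pos (hx k) (Real.exp_pos _))
      Finset.univ_nonempty).ne'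
  · filter_upwards [eventually_gt_atTop 0] with M hM
    obtain ⟨k⟩ := ‹Nonempty b›
    have hpos : 0 < ⌈x k * M⌉₊ := Nat.ceil_pos.2 (mul_pos (hx k) (Nat.cast_pos.2 hM))
    have : Nonempty (Σ k, Fin ⌈x k * M⌉₊) := ⟨⟨k, 0, hpos⟩⟩
    exact bathOperations_rung_subset_spinThermalOperationsWithGaps _

theorem thermalOperations_subset_closure
    (hσ : ∀ μ ∈ spectrum ℂ HS, ∀ ν ∈ spectrum ℂ HS, μ - ν ∈ AddSubgroup.zmultiples (ΔE : ℂ))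
    (T : ℝ≥0∞) : thermalOperations HS T ⊆ closure (spinThermalOperationsWithGaps HS ΔE T) := by
  intro S hS
  obtain ⟨m, HB, hm, hHB, hS⟩ := mem_thermalOperations_iff.1 hS
  have : Nonempty (Fin m) := ⟨⟨0, hm⟩⟩
  set e := hHB.eigenvalues
  have hdiag : S ∈ bathOperations HS T (diagonal fun k => (e k : ℂ)) := by
    rw [hHB.spectral_theorem] at hS
    exact bathOperations_conj_subset HS T _ hHB.eigenvectorUnitary.2 hS
  obtain ⟨B, hB, rfl⟩ := mem_bathOperations_diagonal_iff.1 hdiag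
  obtain ⟨E, r, he, hr⟩ := exists_eq_add_rung ΔE e
  have hrB (l k) (hlk : B l k ≠ 0) : r l = r k := hr l k (hB.sub_mem_zmultiples hσ hlk)
  have hBE : IsEnergyConserving HS (fun k => rung ΔE (E k)) B := by
    refine ⟨hB.mul_conjTranspose, fun l k => ?_⟩
    by_cases hlk : B l k = 0
    · simp [hlk, Ring.lie_def]
    · rw [hB.lie, he, he, hrB l k hlk, add_sub_add_left_eq_sub]
  have hweights : boltzmann T.toReal e =
      fun k => boltzmann T.toReal r k * boltzmann T.toReal (fun k => rung ΔE (E k)) k := by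
    funext k
    rw [boltzmann, boltzmann, boltzmann, he, ← Real.exp_add]
    ring_nf
  rw [hweights]
  exact hBE.krausMixture_mem_closure_withGaps (fun _ => Real.exp_pos _)
    fun l k hlk => by rw [boltzmann, boltzmann, hrB l k hlk]

end SpinBath

theorem corollary1_general {n : ℕ} (HS : Matrix (Fin n) (Fin n) ℂ) (ΔE : ℝ)
    (hσ : ∀ μ ∈ spectrum ℂ HS, ∀ ν ∈ spectrum ℂ HS, μ - ν ∈ AddSubgroup.zmultiples (ΔE : ℂ))
    (T : ℝ≥0∞) (_hT : 0 < T) :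
    closure (spinThermalOperations HS ΔE T) = closure (spinThermalOperationsWithGaps HS ΔE T) ∧
    closure (thermalOperations HS T) = closure (spinThermalOperations HS ΔE T) := by
  have hspin : closure (spinThermalOperations HS ΔE T) =
      closure (spinThermalOperationsWithGaps HS ΔE T) :=
    (closure_mono (spinThermalOperations_subset_withGaps HS ΔE T)).antisymm
      (closure_minimal (spinThermalOperationsWithGaps_subset_closure HS ΔE T) isClosed_closure)
  refine ⟨hspin, hspin ▸ Set.Subset.antisymm ?_ ?_⟩
  · exact closure_minimal (thermalOperations_subset_closure hσ T) isClosed_closure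
  · exact closure_mono (spinThermalOperationsWithGaps_subset_thermalOperations HS ΔE T)

theorem corollary1 {n : ℕ} (HS : Matrix (Fin n) (Fin n) ℂ) (hHS : HS.IsHermitian)
    (E₁ ΔE : ℝ) (hΔE : 0 < ΔE)
    (hσ : spectrum ℂ HS ⊆ Set.range fun j : ℕ => ((E₁ + j * ΔE : ℝ) : ℂ))
    (T : ℝ≥0∞) (hT : 0 < T) :
    closure (spinThermalOperations HS ΔE T) = closure (spinThermalOperationsWithGaps HS ΔE T) ∧
    closure (thermalOperations HS T) = closure (spinThermalOperations HS ΔE T) := by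
  refine corollary1_general HS ΔE (fun μ hμ ν hν => ?_) T hT
  obtain ⟨⟨j, rfl⟩, ⟨k, rfl⟩⟩ := hσ hμ, hσ hν
  exact ⟨j - k, by push_cast [zsmul_eq_mul]; ring⟩
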